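/- Let $k$ be a field, $V=k[[t]]$ with order function $\mathrm{o}(\cdot)$, $H=\langle 5,11\rangle=\{5i+11j \mid i,j\in\mathbb{Z}_{\ge 0}\}$, $c=40$ the conductor of $H$ (the least integer $c$ with $n\in H$ for all $n\ge c$), and $A=k[[t^5,t^{11}]]\subseteq V$, the ring of power series all of whose exponents lie in $H$; it is a one-dimensional Cohen–Macaulay local ring. An ideal $I$ of $A$ primary to the maximal ideal is called an Ulrich ideal if there is a parameter ideal $Q\subseteq I$ with $I\ne Q$ and $I^2=QI$, and $I/I^2$ is a free $A/I$-module. Let $I$ be an Ulrich ideal of $A$. Consider elements $f,g\in I$ which, with $a=\mathrm{o}(f)$ and $b=\mathrm{o}(g)$, satisfy 1. $I=(f,g)$ and $I^2=fI$; 2. $a,b\in H$ and $0<a<b<a+c$; 3. $b-a\notin H$, $2b-a\in H$, and $a=2\,\ell_A(A/I)$; 4. $t^{c-(b-a)}V\cap A\subseteq I$ and $A:V\subseteq I$. Such $f,g$ exist, and for every such choice $(a,b)\neq(10,16)$; more precisely, $(a,b)=(10,27)$ or $(a,b)=(20,26)$. -/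

import Mathlib

open scoped PowerSeries

/-- Ideals of a local ring `A` of dimension `d` which are parameter ideals: `Q` is generated
by `d = dim A` elements and is primary to the maximal ideal. -/
def IsParameterIdeal {A : Type*} [CommRing A] [IsLocalRing A] (Q : Ideal A) : Prop :=
  ∃ (d : ℕ) (x : Fin d → A), ringKrullDim A = d ∧ Q = Ideal.span (Set.range x) ∧
    Q.radical = IsLocalRing.maximalIdeal A

/-- Ulrich ideals of a (Cohen-Macaulay) local ring `A`: `I` is primary to the maximal ideal and,
for some parameter ideal `Q ⊆ I`, one has `I ≠ Q` and `I² = QI` (so that `Q` is a reduction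
of `I`), and `I / I²` is a free `A / I`-module. -/
def IsUlrichIdeal {A : Type*} [CommRing A] [IsLocalRing A] (I : Ideal A) : Prop :=
  I.radical = IsLocalRing.maximalIdeal A ∧
  (∃ Q : Ideal A, IsParameterIdeal Q ∧ Q ≤ I ∧ I ≠ Q ∧ I ^ 2 = Q * I) ∧
  Module.Free (A ⧸ I) I.Cotangent

/-- The length `ℓ_A(A / I)`. -/
noncomputable def colength {A : Type*} [CommRing A] (I : Ideal A) : ℕ∞ :=
  Module.length A (A ⧸ I)

/-- The semigroup ring `k[[H]] = k[[t^h | h ∈ H]]` inside `V = k[[t]]`: the power series all of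
whose exponents lie in `H`. -/
def semigroupRing (k : Type*) [Field k] (H : AddSubmonoid ℕ) : Subalgebra k k⟦X⟧ where
  carrier := {f | ∀ n, PowerSeries.coeff n f ≠ 0 → n ∈ H}
  mul_mem' := by
    intro f g hf hg n hn
    rw [PowerSeries.coeff_mul] at hn
    obtain ⟨p, hp, hne⟩ := Finset.exists_ne_zero_of_sum_ne_zero hn
    rw [← Finset.HasAntidiagonal.mem_antidiagonal.mp hp]
    exact H.add_mem (hf _ (left_ne_zero_of_mul hne)) (hg _ (right_ne_zero_of_mul hne))
  add_mem' := by
    intro f g hf hg n hn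
    by_cases h : PowerSeries.coeff n f = 0
    · refine hg n fun h' => hn ?_
      rw [map_add, h, h', add_zero]
    · exact hf n h
  algebraMap_mem' := by
    intro r n hn
    rw [PowerSeries.algebraMap_apply, PowerSeries.coeff_C] at hn
    by_cases h : n = 0
    · rw [h]; exact H.zero_mem
    · simp [h] at hn

theorem inv_mem_semigroupRing {k : Type*} [Field k] {H : AddSubmonoid ℕ} {f : k⟦X⟧}
    (hf : f ∈ semigroupRing k H) : f⁻¹ ∈ semigroupRing k H := by
  intro n
  induction n using Nat.strong_induction_on with
  | _ n ih =>
    intro hn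
    by_cases h0 : n = 0
    · rw [h0]; exact H.zero_mem
    rw [PowerSeries.coeff_inv, if_neg h0] at hn
    obtain ⟨p, hp, hne⟩ := Finset.exists_ne_zero_of_sum_ne_zero (right_ne_zero_of_mul hn)
    by_cases hlt : p.2 < n
    · rw [if_pos hlt] at hne
      rw [← Finset.HasAntidiagonal.mem_antidiagonal.mp hp]
      exact H.add_mem (hf _ (left_ne_zero_of_mul hne)) (ih _ hlt (right_ne_zero_of_mul hne))
    · rw [if_neg hlt] at hne
      exact absurd rfl hne

/-- The semigroup ring is a local ring. -/
instance (k : Type*) [Field k] (H : AddSubmonoid ℕ) : IsLocalRing (semigroupRing k H) := by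
  have key : ∀ f : semigroupRing k H, PowerSeries.constantCoeff (f : k⟦X⟧) ≠ 0 → IsUnit f := by
    intro f hf
    refine IsUnit.of_mul_eq_one ⟨(f : k⟦X⟧)⁻¹, inv_mem_semigroupRing f.2⟩ ?_
    exact Subtype.ext (PowerSeries.mul_inv_cancel _ hf)
  refine IsLocalRing.of_isUnit_or_isUnit_one_sub_self fun f => ?_
  by_cases hf : PowerSeries.constantCoeff (f : k⟦X⟧) = 0
  · right
    apply key
    simp [hf]
  · exact Or.inl (key f hf)

/-- The conductor `c(H)` of a numerical semigroup `H`: the least `c` such that every `n ≥ c`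
lies in `H`. -/
noncomputable def semigroupConductor (H : AddSubmonoid ℕ) : ℕ :=
  sInf {c | ∀ n, c ≤ n → n ∈ H}

/-- The elements `f, g` form a normalized pair of generators of the ideal `I` of `A = k[[H]]`,
with invariants `a = o(f)` and `b = o(g)`, where `o` is the order function of `V = k[[t]]`. -/
structure IsNormalizedPair {k : Type*} [Field k] {H : AddSubmonoid ℕ}
    (I : Ideal (semigroupRing k H)) (f g : semigroupRing k H) (a b : ℕ) : Prop where
  order_f : (f : k⟦X⟧).order = a
  order_g : (g : k⟦X⟧).order = b
  eq_span : I = Ideal.span {f, g}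
  sq_eq : I ^ 2 = Ideal.span {f} * I
  a_mem : a ∈ H
  b_mem : b ∈ H
  a_pos : 0 < a
  a_lt_b : a < b
  b_lt : b < a + semigroupConductor H
  sub_notMem : b - a ∉ H
  two_mul_sub_mem : 2 * b - a ∈ H
  /-- `a = 2 ℓ_A(A / I)` -/
  a_eq : (a : ℕ∞) = 2 * colength I
  /-- `t ^ (c - (b - a)) V ∩ A ⊆ I` -/
  mem_of_le_order : ∀ x : semigroupRing k H,
    ((semigroupConductor H - (b - a) : ℕ) : ℕ∞) ≤ (x : k⟦X⟧).order → x ∈ I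
  /-- `A : V ⊆ I` -/
  conductor_le : ∀ x : semigroupRing k H,
    (∀ v : k⟦X⟧, (x : k⟦X⟧) * v ∈ semigroupRing k H) → x ∈ I

/-! Everything is read off from the set T of orders of elements of I (`orderSet`). Suppose I² = fI
with o(f) = a. Then T lies in H, has minimum a, and m + n - a ∈ T for all m, n ∈ T. Since 39 ∉ H,
the numbers n and 39 + a - n are never both in T. Lengths are counted by orders: ℓ(A/I) = a + 20 -
|T ∩ [0, a + 40)|, where 20 is the number of gaps of H. Together these give a ≤ 2ℓ(A/I). Equality
forces T to contain every n ≥ 40, and one of n, 39 + a - n for each n in [a, 40) (`card_bounds` and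
its corollaries).

Uniqueness: a normalized pair has a = 2ℓ(A/I), so a is an even element of H with 0 < a ≤ 40. The
symmetry of T produces orders that I = (f, g) must realize, and for d = b - a only few orders are
possible (`isPossibleOrder_of_mem_orderSet`). A finite check over the ten values of a leaves the two
pairs (`IsReducedOrderSet.classification`).

Existence: for an Ulrich ideal, Q = (f). If r is the rank of I/I², then ℓ(A/I²) equals both (r +
1)ℓ(A/I) and a + ℓ(A/I), so a = rℓ(A/I) and r ≤ 2. Rank 0 contradicts a > 0, and rank 1 forces I =
(f), so r = 2 (`rank_cotangent_eq_two`). Hence I = (f, g), with g = fh and h supported on the gaps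
of H. The condition on elements of large order follows from A : h ⊆ I, a duality statement that
again rests on the symmetry of T (`mem_of_mul_mem`). -/

/-! ### Lengths of quotients over a commutative ring. -/

theorem colength_top {A : Type*} [CommRing A] : colength (⊤ : Ideal A) = 0 := by
  have : Subsingleton (A ⧸ (⊤ : Ideal A)) := Ideal.Quotient.subsingleton_iff.mpr rfl
  exact Module.length_eq_zero

/-- Multiplication by u identifies A/m with J'/J; it is injective because A/m is simple and u ∉ J.
-/
theorem colength_eq_one_add {A : Type*} [CommRing A] {J J' : Ideal A} (m : Ideal A) [m.IsMaximal]
    {u : A} (hle : J ≤ J') (huJ' : u ∈ J') (huJ : u ∉ J) (hm : ∀ x ∈ m, u * x ∈ J)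
    (h : ∀ x ∈ J', ∃ c, x - u * c ∈ J) : colength J = 1 + colength J' := by
  let φ : (A ⧸ m) →ₗ[A] A ⧸ J := Submodule.mapQ m J (LinearMap.mulLeft A u) hm
  have hφ : ∀ x : A, φ (Submodule.Quotient.mk x) = Submodule.Quotient.mk (u * x) := fun x => rfl
  have hsimple : IsSimpleModule A (A ⧸ m) :=
    isSimpleModule_iff_isCoatom.mpr (Ideal.IsMaximal.out (I := m))
  have hinj : Function.Injective φ := by
    refine (LinearMap.injective_or_eq_zero φ).resolve_right fun h0 => huJ ?_
    have h1 := hφ 1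
    rwa [h0, LinearMap.zero_apply, mul_one, eq_comm, Submodule.Quotient.mk_eq_zero] at h1
  have hex : Function.Exact φ (Submodule.factor hle) := by
    intro y
    obtain ⟨x, rfl⟩ := Submodule.Quotient.mk_surjective _ y
    constructor
    · intro hx
      rw [← Submodule.mkQ_apply, Submodule.factor_mk, Submodule.mkQ_apply,
        Submodule.Quotient.mk_eq_zero] at hx
      obtain ⟨c, hc⟩ := h x hx
      refine ⟨Submodule.Quotient.mk c, ?_⟩
      rwa [hφ, eq_comm, Submodule.Quotient.eq]
    · rintro ⟨w, hw⟩
      obtain ⟨x', rfl⟩ := Submodule.Quotient.mk_surjective _ w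
      rw [← hw, hφ, ← Submodule.mkQ_apply, Submodule.factor_mk, Submodule.mkQ_apply,
        Submodule.Quotient.mk_eq_zero]
      exact Ideal.mul_mem_right _ _ huJ'
  rw [colength, Module.length_eq_add_of_exact φ (Submodule.factor hle) hinj
    (Submodule.factor_surjective hle) hex, Module.length_eq_one, colength]

/-- Additivity of length on 0 → I/I² → A/I² → A/I → 0. -/
theorem colength_sq {A : Type*} [CommRing A] (I : Ideal A) [Module.Free (A ⧸ I) I.Cotangent] :
    colength (I ^ 2) =
      (Module.rank (A ⧸ I) I.Cotangent).toENat * colength I + colength I := by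
  have hle : I ^ 2 ≤ I := Ideal.pow_le_self two_ne_zero
  rw [colength, Module.length_eq_add_of_exact I.cotangentToQuotientSquare (Submodule.factor hle)
    I.cotangentToQuotientSquare_injective (Submodule.factor_surjective hle)]
  · congr 1
    have hs : Function.Surjective (algebraMap A (A ⧸ I)) := Ideal.Quotient.mk_surjective
    rw [Module.length_eq_of_surjective (R := A ⧸ I) hs, Module.length_of_free, colength,
      Module.length_eq_of_surjective (R := A ⧸ I) hs]
  · intro y
    obtain ⟨x, rfl⟩ := Submodule.Quotient.mk_surjective _ y
    constructor
    · intro hx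
      rw [← Submodule.mkQ_apply, Submodule.factor_mk, Submodule.mkQ_apply,
        Submodule.Quotient.mk_eq_zero] at hx
      exact ⟨I.toCotangent ⟨x, hx⟩, I.toCotangent_to_quotient_square _⟩
    · rintro ⟨w, hw⟩
      obtain ⟨x', rfl⟩ := I.toCotangent_surjective w
      rw [← hw, I.toCotangent_to_quotient_square, Submodule.factor_mk, Submodule.mkQ_apply,
        Submodule.Quotient.mk_eq_zero]
      exact x'.2

/-! ### Orders of elements and ideals of k[[H]]. -/

namespace SemigroupRing

variable {k : Type*} [Field k] {H : AddSubmonoid ℕ}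

theorem coe_ne_zero {x : semigroupRing k H} (hx : x ≠ 0) : (x : k⟦X⟧) ≠ 0 := by
  simpa using hx

theorem exists_order_eq {x : k⟦X⟧} (hx : x ≠ 0) : ∃ n : ℕ, x.order = n :=
  ⟨_, (PowerSeries.coe_toNat_order hx).symm⟩

theorem ne_zero_of_order_eq {x : k⟦X⟧} {n : ℕ} (hx : x.order = n) : x ≠ 0 := by
  rintro rfl
  simp at hx

theorem coeff_ne_zero_of_order_eq {x : k⟦X⟧} {n : ℕ} (hx : x.order = n) :
    PowerSeries.coeff n x ≠ 0 :=
  (PowerSeries.order_eq_nat.mp hx).1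

theorem mem_of_order_eq {x : semigroupRing k H} {n : ℕ} (hx : (x : k⟦X⟧).order = n) : n ∈ H :=
  x.2 n (coeff_ne_zero_of_order_eq hx)

theorem mem_of_le_order {c : ℕ} (hc : ∀ n, c ≤ n → n ∈ H) {x : k⟦X⟧} (hx : (c : ℕ∞) ≤ x.order) :
    x ∈ semigroupRing k H := fun n hn =>
  hc n (by exact_mod_cast hx.trans (PowerSeries.order_le n hn))

theorem monomial_mem {n : ℕ} (hn : n ∈ H) : PowerSeries.monomial n (1 : k) ∈ semigroupRing k H := by
  intro m hm
  rw [PowerSeries.coeff_monomial] at hm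
  split_ifs at hm with h
  · exact h ▸ hn
  · exact absurd rfl hm

theorem exists_eq_mul_of_order_le {f x : k⟦X⟧} {a m : ℕ} (hf : f.order = a)
    (hx : ((a + m : ℕ) : ℕ∞) ≤ x.order) : ∃ y : k⟦X⟧, x = f * y ∧ (m : ℕ∞) ≤ y.order := by
  have h0 : f ≠ 0 := ne_zero_of_order_eq hf
  obtain ⟨z, hz⟩ := (PowerSeries.X_pow_dvd_iff (n := a) (φ := x)).mpr fun i hi =>
    PowerSeries.coeff_of_lt_order i (lt_of_lt_of_le (by exact_mod_cast by omega) hx)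
  have hfX : f = PowerSeries.X ^ a * PowerSeries.divXPowOrder f := by
    conv_lhs => rw [← PowerSeries.X_pow_order_mul_divXPowOrder (f := f)]
    simp [hf]
  have hxy : x = f * (PowerSeries.Inv_divided_by_X_pow_order h0 * z) := by
    calc x = PowerSeries.X ^ a * (PowerSeries.divXPowOrder f *
          PowerSeries.Inv_divided_by_X_pow_order h0) * z := by
          rw [PowerSeries.Inv_divided_by_X_pow_order_rightInv, mul_one, hz]
      _ = (PowerSeries.X ^ a * PowerSeries.divXPowOrder f) *
          (PowerSeries.Inv_divided_by_X_pow_order h0 * z) := by ring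
      _ = _ := by rw [← hfX]
  refine ⟨_, hxy, ?_⟩
  rw [hxy, PowerSeries.order_mul, hf, Nat.cast_add] at hx
  exact (ENat.add_le_add_iff_left (ENat.natCast_ne_top a)).mp hx

theorem exists_sub_smul_order_lt {x y : k⟦X⟧} {n : ℕ} (hx : (n : ℕ∞) ≤ x.order)
    (hy : y.order = n) : ∃ c : k, ((n + 1 : ℕ) : ℕ∞) ≤ (x - c • y).order := by
  have hy0 := coeff_ne_zero_of_order_eq hy
  refine ⟨PowerSeries.coeff n x / PowerSeries.coeff n y, PowerSeries.nat_le_order _ _ fun i hi => ?_⟩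
  rw [map_sub, PowerSeries.coeff_smul]
  rcases Nat.lt_succ_iff_lt_or_eq.mp hi with h | rfl
  · rw [PowerSeries.coeff_of_lt_order i (lt_of_lt_of_le (by exact_mod_cast h) hx),
      PowerSeries.coeff_of_lt_order i (by rw [hy]; exact_mod_cast h)]
    simp
  · rw [smul_eq_mul, div_mul_cancel₀ _ hy0, sub_self]

theorem isUnit_of_constantCoeff_ne_zero {x : semigroupRing k H}
    (hx : PowerSeries.constantCoeff (x : k⟦X⟧) ≠ 0) : IsUnit x :=
  IsUnit.of_mul_eq_one ⟨(x : k⟦X⟧)⁻¹, inv_mem_semigroupRing x.2⟩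
    (Subtype.ext (PowerSeries.mul_inv_cancel _ hx))

theorem isUnit_iff_order_eq_zero {x : semigroupRing k H} :
    IsUnit x ↔ (x : k⟦X⟧).order = 0 := by
  constructor
  · intro h
    exact PowerSeries.order_zero_of_unit (h.map (semigroupRing k H).val)
  · intro h
    exact isUnit_of_constantCoeff_ne_zero
      (by simpa using coeff_ne_zero_of_order_eq (n := 0) (by simpa using h))

theorem mem_maximalIdeal_iff {x : semigroupRing k H} :
    x ∈ IsLocalRing.maximalIdeal (semigroupRing k H) ↔ 1 ≤ (x : k⟦X⟧).order := by
  rw [IsLocalRing.mem_maximalIdeal, mem_nonunits_iff, isUnit_iff_order_eq_zero,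
    Order.one_le_iff_ne_zero]

/-- The set of orders of the elements of an ideal of `k[[H]]`. -/
def orderSet (I : Ideal (semigroupRing k H)) : Set ℕ :=
  {n | ∃ x ∈ I, (x : k⟦X⟧).order = n}

theorem orderSet_subset {I : Ideal (semigroupRing k H)} {n : ℕ} (hn : n ∈ orderSet I) : n ∈ H := by
  obtain ⟨x, -, hx⟩ := hn
  exact mem_of_order_eq hx

theorem add_mem_orderSet {I : Ideal (semigroupRing k H)} {n h : ℕ} (hn : n ∈ orderSet I)
    (hh : h ∈ H) : n + h ∈ orderSet I := by
  obtain ⟨x, hx, hxn⟩ := hn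
  refine ⟨x * ⟨_, monomial_mem hh⟩, I.mul_mem_right _ hx, ?_⟩
  rw [MulMemClass.coe_mul, PowerSeries.order_mul, hxn,
    PowerSeries.order_monomial_of_ne_zero _ _ one_ne_zero, Nat.cast_add]

/-- The ideal of elements of `k[[H]]` of order at least `n`. -/
def orderIdeal (k : Type*) [Field k] (H : AddSubmonoid ℕ) (n : ℕ) : Ideal (semigroupRing k H) where
  carrier := {x | (n : ℕ∞) ≤ (x : k⟦X⟧).order}
  add_mem' := fun {x y} hx hy =>
    (le_min hx hy).trans (PowerSeries.min_order_le_order_add (x : k⟦X⟧) y)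
  zero_mem' := by simp
  smul_mem' := fun c x hx => by
    simp only [Set.mem_ofPred_eq, smul_eq_mul, MulMemClass.coe_mul, PowerSeries.order_mul] at hx ⊢
    exact hx.trans le_add_self

theorem mem_orderIdeal {n : ℕ} {x : semigroupRing k H} :
    x ∈ orderIdeal k H n ↔ (n : ℕ∞) ≤ (x : k⟦X⟧).order := Iff.rfl

theorem orderIdeal_anti {m n : ℕ} (h : m ≤ n) : orderIdeal k H n ≤ orderIdeal k H m :=
  fun x hx => le_trans (by exact_mod_cast h) (mem_orderIdeal.mp hx)

/-- The leading term of an element of J is cancelled by a scalar multiple of an element of I,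
repeatedly, until the order reaches N. -/
theorem le_of_orderSet_subset {I J : Ideal (semigroupRing k H)} {N : ℕ} (hIJ : I ≤ J)
    (hN : orderIdeal k H N ≤ I) (h : ∀ n < N, n ∈ orderSet J → n ∈ orderSet I) : J ≤ I := by
  have key : ∀ m ≤ N, ∀ x ∈ J, x ∈ orderIdeal k H (N - m) → x ∈ I := by
    intro m
    induction m with
    | zero => intro _ x _ hx; exact hN hx
    | succ m ih =>
      intro hm x hxJ hx
      rw [mem_orderIdeal] at hx
      obtain ⟨n, hn⟩ : ∃ n, n = N - (m + 1) := ⟨_, rfl⟩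
      rw [← hn] at hx
      have hn1 : N - m = n + 1 := by omega
      rcases hx.lt_or_eq with hlt | heq
      · exact ih (by omega) x hxJ (by
          rw [mem_orderIdeal, hn1, Nat.cast_add, Nat.cast_one]
          exact Order.add_one_le_of_lt hlt)
      · obtain ⟨y, hyI, hy⟩ := h n (by omega) ⟨x, hxJ, heq.symm⟩
        obtain ⟨c, hc⟩ := exists_sub_smul_order_lt hx hy
        have hcy : c • y ∈ I := I.smul_of_tower_mem c hyI
        have := ih (by omega) (x - c • y) (J.sub_mem hxJ (hIJ hcy)) (by
          rw [mem_orderIdeal, hn1]; exact hc)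
        simpa using I.add_mem this hcy
  exact fun x hx => key N le_rfl x hx (by simp [mem_orderIdeal])

/-- Summands of order at least c cannot affect a leading term below c. -/
theorem mem_orderSet_of_mem_sup {I : Ideal (semigroupRing k H)} {n c : ℕ} (hnc : n < c)
    {x : semigroupRing k H} (hx : x ∈ I ⊔ orderIdeal k H c) (hxn : (x : k⟦X⟧).order = n) :
    n ∈ orderSet I := by
  obtain ⟨i, hi, z, hz, rfl⟩ := Submodule.mem_sup.mp hx
  refine ⟨i, hi, ?_⟩
  have hz' : (n : ℕ∞) < (z : k⟦X⟧).order :=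
    lt_of_lt_of_le (by exact_mod_cast hnc) (mem_orderIdeal.mp hz)
  have h1 : (i : k⟦X⟧) = (i + z : semigroupRing k H) + -(z : k⟦X⟧) := by simp
  rw [h1, PowerSeries.order_add_of_order_ne _ _ (by
    rw [hxn, PowerSeries.order_neg]; exact hz'.ne), hxn, PowerSeries.order_neg]
  exact min_eq_left hz'.le

theorem orderIdeal_le_of_mem_orderSet {I : Ideal (semigroupRing k H)} {N c : ℕ}
    (hN : orderIdeal k H N ≤ I) (h : ∀ n, c ≤ n → n ∈ orderSet I) : orderIdeal k H c ≤ I := by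
  refine le_trans le_sup_right (le_of_orderSet_subset (J := I ⊔ orderIdeal k H c) le_sup_left hN ?_)
  rintro n - ⟨x, hx, hxn⟩
  by_cases hcn : c ≤ n
  · exact h n hcn
  · exact mem_orderSet_of_mem_sup (not_le.mp hcn) hx hxn

theorem colength_sup_orderIdeal_succ (I : Ideal (semigroupRing k H)) {n : ℕ} (hn : n ∈ H)
    (hnI : n ∉ orderSet I) :
    colength (I ⊔ orderIdeal k H (n + 1)) = 1 + colength (I ⊔ orderIdeal k H n) := by
  let u : semigroupRing k H := ⟨_, monomial_mem hn⟩
  have hu : (u : k⟦X⟧).order = n := PowerSeries.order_monomial_of_ne_zero _ _ one_ne_zero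
  refine colength_eq_one_add (IsLocalRing.maximalIdeal (semigroupRing k H)) (u := u)
    (sup_le_sup_left (orderIdeal_anti (Nat.le_succ n)) _) ?_ ?_ ?_ ?_
  · exact (le_sup_right : orderIdeal k H n ≤ _) (mem_orderIdeal.mpr hu.ge)
  · exact fun h => hnI (mem_orderSet_of_mem_sup n.lt_succ_self h hu)
  · intro x hx
    have hx1 := mem_maximalIdeal_iff.mp hx
    refine (le_sup_right : orderIdeal k H (n + 1) ≤ _) (mem_orderIdeal.mpr ?_)
    rw [MulMemClass.coe_mul, PowerSeries.order_mul, hu, Nat.cast_add, Nat.cast_one]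
    gcongr
  · intro x hx
    obtain ⟨i, hi, z, hz, rfl⟩ := Submodule.mem_sup.mp hx
    obtain ⟨c, hc⟩ := exists_sub_smul_order_lt (mem_orderIdeal.mp hz) hu
    refine ⟨algebraMap k _ c, ?_⟩
    have h2 : i + z - u * algebraMap k (semigroupRing k H) c = i + (z - c • u) := by
      rw [Algebra.smul_def]; ring
    rw [h2]
    exact Submodule.add_mem_sup hi hc

theorem sup_orderIdeal_succ_eq (I : Ideal (semigroupRing k H)) {n : ℕ}
    (hn : n ∈ H → n ∈ orderSet I) : I ⊔ orderIdeal k H (n + 1) = I ⊔ orderIdeal k H n := by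
  refine le_antisymm (sup_le_sup_left (orderIdeal_anti (Nat.le_succ n)) _)
    (sup_le le_sup_left fun x hx => ?_)
  rcases (mem_orderIdeal.mp hx).lt_or_eq with hlt | heq
  · exact (le_sup_right : orderIdeal k H (n + 1) ≤ _) (by
      rw [mem_orderIdeal, Nat.cast_add, Nat.cast_one]; exact Order.add_one_le_of_lt hlt)
  · obtain ⟨y, hyI, hy⟩ := hn (mem_of_order_eq heq.symm)
    obtain ⟨c, hc⟩ := exists_sub_smul_order_lt (mem_orderIdeal.mp hx) hy
    have h1 : x = c • y + (x - c • y) := by ring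
    rw [h1]
    exact Submodule.add_mem_sup (I.smul_of_tower_mem c hyI) hc

open Classical in
-- In the filtration by I + {o ≥ n}, the step at n has length 1 when n ∈ H is not an order of I, and
-- length 0 otherwise.
theorem colength_sup_orderIdeal (I : Ideal (semigroupRing k H)) (n : ℕ) :
    colength (I ⊔ orderIdeal k H n) =
      ((Finset.range n).filter (fun m => m ∈ H ∧ m ∉ orderSet I)).card := by
  induction n with
  | zero =>
    have h : I ⊔ orderIdeal k H 0 = ⊤ := by
      refine top_le_iff.mp (le_trans (fun x _ => ?_) le_sup_right)
      simp [mem_orderIdeal]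
    rw [h]
    simp [colength_top]
  | succ n ih =>
    rw [Finset.range_add_one, Finset.filter_insert]
    split_ifs with h
    · rw [colength_sup_orderIdeal_succ I h.1 h.2, ih, Finset.card_insert_of_notMem (by simp)]
      push_cast
      ring
    · rw [sup_orderIdeal_succ_eq I (fun hn => by_contra fun hI => h ⟨hn, hI⟩), ih]

open Classical in
theorem colength_eq_card {I : Ideal (semigroupRing k H)} {N : ℕ} (hN : orderIdeal k H N ≤ I) :
    colength I = ((Finset.range N).filter (fun m => m ∈ H ∧ m ∉ orderSet I)).card := by
  rw [← colength_sup_orderIdeal, sup_eq_left.mpr hN]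

end SemigroupRing

/-! ### The semigroup ⟨5, 11⟩ and the counting argument for T. -/

namespace SemigroupRing

/-- Five copies of 11 can be traded for eleven of 5, so j < 5 suffices and membership is decidable.
-/
theorem mem_closure_five_eleven_iff {n : ℕ} :
    n ∈ AddSubmonoid.closure ({5, 11} : Set ℕ) ↔ ∃ j < 5, 11 * j ≤ n ∧ (n - 11 * j) % 5 = 0 := by
  simp only [AddSubmonoid.mem_closure_pair, smul_eq_mul]
  constructor
  · rintro ⟨i, j, rfl⟩
    exact ⟨j % 5, by omega, by omega, by omega⟩
  · rintro ⟨j, -, h1, h2⟩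
    exact ⟨(n - 11 * j) / 5, j, by omega⟩

instance decidableMemClosureFiveEleven (n : ℕ) :
    Decidable (n ∈ AddSubmonoid.closure ({5, 11} : Set ℕ)) :=
  decidable_of_iff _ mem_closure_five_eleven_iff.symm

theorem mem_closure_of_forty_le {n : ℕ} (hn : 40 ≤ n) :
    n ∈ AddSubmonoid.closure ({5, 11} : Set ℕ) :=
  mem_closure_five_eleven_iff.mpr ⟨n % 5, by omega, by omega, by omega⟩

theorem thirtyNine_notMem : 39 ∉ AddSubmonoid.closure ({5, 11} : Set ℕ) := by decide

theorem semigroupConductor_five_eleven :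
    semigroupConductor (AddSubmonoid.closure ({5, 11} : Set ℕ)) = 40 := by
  refine le_antisymm (Nat.sInf_le fun n hn => mem_closure_of_forty_le hn) ?_
  refine le_csInf ⟨40, fun n hn => mem_closure_of_forty_le hn⟩ fun c hc => ?_
  by_contra h
  exact thirtyNine_notMem (hc 39 (by omega))

theorem card_filter_mem_closure {N : ℕ} (hN : 40 ≤ N) :
    ((Finset.range N).filter (· ∈ AddSubmonoid.closure ({5, 11} : Set ℕ))).card + 20 = N := by
  induction N, hN using Nat.le_induction with
  | base => decide
  | succ n hn ih =>
    rw [Finset.range_add_one, Finset.filter_insert, if_pos (mem_closure_of_forty_le hn),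
      Finset.card_insert_of_notMem (by simp)]
    omega

/-- The properties of the set of orders of an ideal `I = (f, …)` of `k[[H]]`, `H = ⟨5, 11⟩`, such
that `I ^ 2 = f I` and `f` has order `a`. -/
structure IsReducedOrderSet (T : Set ℕ) (a : ℕ) : Prop where
  mem_closure : ∀ n ∈ T, n ∈ AddSubmonoid.closure ({5, 11} : Set ℕ)
  self_mem : a ∈ T
  le : ∀ n ∈ T, a ≤ n
  add_sub_mem : ∀ m ∈ T, ∀ n ∈ T, m + n - a ∈ T

namespace IsReducedOrderSet

variable {T : Set ℕ} {a l : ℕ}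

theorem notMem (hT : IsReducedOrderSet T a) {n : ℕ}
    (hn : n ∉ AddSubmonoid.closure ({5, 11} : Set ℕ)) : n ∉ T :=
  fun h => hn (hT.mem_closure n h)

/-- Otherwise n + (39 + a - n) - a = 39 would lie in T. -/
theorem reflect_notMem (hT : IsReducedOrderSet T a) {n : ℕ} (hn : n ∈ T) (h : n ≤ 39 + a) :
    39 + a - n ∉ T := fun h' => hT.notMem thirtyNine_notMem (by
  have := hT.add_sub_mem _ hn _ h'
  rwa [Nat.add_sub_cancel' h, Nat.add_sub_cancel] at this)

open Classical in
theorem card_add_card_eq_and_union_subset (hT : IsReducedOrderSet T a) :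
    ((Finset.range (a + 40)).filter (· ∈ T)).card + ((Finset.Ico a 40).filter (39 + a - · ∈ T)).card
      = ((Finset.range (a + 40)).filter (· ∈ T) ∪ (Finset.Ico a 40).filter (39 + a - · ∈ T)).card ∧
    (Finset.range (a + 40)).filter (· ∈ T) ∪ (Finset.Ico a 40).filter (39 + a - · ∈ T) ⊆
      Finset.Ico a (a + 40) := by
  constructor
  · refine (Finset.card_union_of_disjoint (Finset.disjoint_left.mpr fun n hn hn' => ?_)).symm
    rw [Finset.mem_filter] at hn hn'
    rw [Finset.mem_range] at hn
    exact hT.reflect_notMem hn.2 (by omega) hn'.2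
  · intro n hn
    simp only [Finset.mem_union, Finset.mem_filter, Finset.mem_range, Finset.mem_Ico] at hn ⊢
    rcases hn with ⟨h1, h2⟩ | ⟨h1, -⟩
    · exact ⟨hT.le n h2, h1⟩
    · omega

open Classical in
theorem card_reflect :
    ((Finset.Ico a 40).filter (39 + a - · ∈ T)).card = ((Finset.Ico a 40).filter (· ∈ T)).card := by
  refine Finset.card_nbij' (39 + a - ·) (39 + a - ·) ?_ ?_ ?_ ?_ <;> intro n hn <;>
    simp only [Finset.coe_filter, Finset.mem_Ico, Set.mem_ofPred_eq] at hn ⊢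
  · exact ⟨by omega, hn.2⟩
  · refine ⟨by omega, ?_⟩
    rw [show 39 + a - (39 + a - n) = n by omega]
    exact hn.2
  · omega
  · omega

open Classical in
theorem card_filter_range_le (hT : IsReducedOrderSet T a) :
    ((Finset.range (a + 40)).filter (· ∈ T)).card ≤
      ((Finset.Ico a 40).filter (39 + a - · ∈ T)).card +
        ((Finset.Ico 40 (a + 40)).filter (· ∈ T)).card := by
  rw [card_reflect]
  refine (Finset.card_le_card fun n hn => ?_).trans (Finset.card_union_le _ _)
  simp only [Finset.mem_union, Finset.mem_filter, Finset.mem_range, Finset.mem_Ico] at hn ⊢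
  have := hT.le n hn.2
  by_cases h40 : n < 40
  · exact Or.inl ⟨⟨this, h40⟩, hn.2⟩
  · exact Or.inr ⟨⟨by omega, hn.1⟩, hn.2⟩

open Classical in
-- Adding the first two bounds and using the third gives 2|T ∩ [0, a + 40)| ≤ 40 + a. When a = 2l,
-- all the bounds that enter are equalities.
theorem card_bounds (hT : IsReducedOrderSet T a) :
    ((Finset.range (a + 40)).filter (· ∈ T)).card +
      ((Finset.Ico a 40).filter (39 + a - · ∈ T)).card ≤ 40 ∧
    ((Finset.range (a + 40)).filter (· ∈ T)).card ≤
      ((Finset.Ico a 40).filter (39 + a - · ∈ T)).card +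
        ((Finset.Ico 40 (a + 40)).filter (· ∈ T)).card ∧
    ((Finset.Ico 40 (a + 40)).filter (· ∈ T)).card ≤ a := by
  refine ⟨?_, ?_, ?_⟩
  · rw [hT.card_add_card_eq_and_union_subset.1]
    simpa using Finset.card_le_card hT.card_add_card_eq_and_union_subset.2
  · exact hT.card_filter_range_le
  · simpa using Finset.card_filter_le (Finset.Ico 40 (a + 40)) (· ∈ T)

open Classical in
theorem le_two_mul (hT : IsReducedOrderSet T a)
    (hl : l + ((Finset.range (a + 40)).filter (· ∈ T)).card = a + 20) : a ≤ 2 * l := by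
  have := hT.card_bounds
  omega

open Classical in
theorem mem_of_forty_le (hT : IsReducedOrderSet T a)
    (hl : l + ((Finset.range (a + 40)).filter (· ∈ T)).card = a + 20) (ha : a = 2 * l)
    (h0 : 0 < a) (hH : ∀ n ∈ T, ∀ h ∈ AddSubmonoid.closure ({5, 11} : Set ℕ), n + h ∈ T)
    {n : ℕ} (hn : 40 ≤ n) : n ∈ T := by
  have hb := hT.card_bounds
  by_cases h : n < a + 40
  · have h1 : (Finset.Ico 40 (a + 40)).filter (· ∈ T) = Finset.Ico 40 (a + 40) := by
      refine Finset.eq_of_subset_of_card_le (Finset.filter_subset _ _) ?_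
      rw [Nat.card_Ico]
      omega
    exact (Finset.filter_eq_self.mp h1) n (by simp [hn, h])
  -- Beyond a + 40 no counting is needed: n - a is past the conductor.
  · have := hH a hT.self_mem (n - a) (mem_closure_of_forty_le (by omega))
    rwa [Nat.add_sub_cancel' (by omega)] at this

open Classical in
theorem mem_or_reflect_mem (hT : IsReducedOrderSet T a)
    (hl : l + ((Finset.range (a + 40)).filter (· ∈ T)).card = a + 20) (ha : a = 2 * l)
    {n : ℕ} (han : a ≤ n) (hn : n < 40) : n ∈ T ∨ 39 + a - n ∈ T := by
  have hb := hT.card_bounds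
  have h1 := Finset.eq_of_subset_of_card_le hT.card_add_card_eq_and_union_subset.2 (by
    rw [← hT.card_add_card_eq_and_union_subset.1, Nat.card_Ico]
    omega)
  have h2 : n ∈ Finset.Ico a (a + 40) := by simp; omega
  rw [← h1, Finset.mem_union, Finset.mem_filter, Finset.mem_filter] at h2
  tauto

end IsReducedOrderSet

/-- `n` is the order of an element of `A + A h`, where `A = k[[H]]`, `H = ⟨5, 11⟩`, for some `h` of
order `d`, unless this is excluded by the orders of the elements of `A` and `A h`. -/
def IsPossibleOrder (d n : ℕ) : Prop :=
  n ∈ AddSubmonoid.closure ({5, 11} : Set ℕ) ∨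
    (d ≤ n ∧ n - d ∈ AddSubmonoid.closure ({5, 11} : Set ℕ)) ∨
    ∃ m < n, d ≤ m ∧ m ∈ AddSubmonoid.closure ({5, 11} : Set ℕ) ∧
      m - d ∈ AddSubmonoid.closure ({5, 11} : Set ℕ)

instance (d n : ℕ) : Decidable (IsPossibleOrder d n) := by
  unfold IsPossibleOrder; infer_instance

end SemigroupRing

/-! ### Finite check of the possible pairs (a, d). -/

namespace SemigroupRing
namespace IsReducedOrderSet

variable {T : Set ℕ} {a : ℕ}

theorem notMem_of_double (hT : IsReducedOrderSet T a) {n : ℕ}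
    (hn : n + n - a ∉ AddSubmonoid.closure ({5, 11} : Set ℕ)) : n ∉ T :=
  fun h => hT.notMem hn (hT.add_sub_mem n h n h)

/-- The restrictions on the difference `d` of the orders of two generators of an ideal `I` whose
orders include `a` and `a + s` for `s ∈ S`. -/
def IsPossibleDifference (a : ℕ) (S : List ℕ) (d : ℕ) : Prop :=
  d ∉ AddSubmonoid.closure ({5, 11} : Set ℕ) ∧
    a + d ∈ AddSubmonoid.closure ({5, 11} : Set ℕ) ∧
    a + d + (a + d) - a ∈ AddSubmonoid.closure ({5, 11} : Set ℕ) ∧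
    ∀ s ∈ S, IsPossibleOrder d s

instance (a : ℕ) (S : List ℕ) (d : ℕ) : Decidable (IsPossibleDifference a S d) := by
  unfold IsPossibleDifference; infer_instance

theorem classification (hT : IsReducedOrderSet T a)
    (hbig : ∀ n, 40 ≤ n → n ∈ T)
    (hsym : ∀ n, a ≤ n → n < 40 → n ∈ T ∨ 39 + a - n ∈ T) (h40 : a ≤ 40) (h0 : 0 < a)
    (heven : Even a) {d : ℕ} (hd : d < 40) (hdH : d ∉ AddSubmonoid.closure ({5, 11} : Set ℕ))
    (hdT : a + d ∈ T) (hposs : ∀ n, a + n ∈ T → IsPossibleOrder d n) :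
    (a = 10 ∧ d = 17) ∨ (a = 20 ∧ d = 6) := by
  have hdiff : ∀ S : List ℕ, (∀ s ∈ S, a + s ∈ T) → IsPossibleDifference a S d := fun S hS =>
    ⟨hdH, hT.mem_closure _ hdT, hT.mem_closure _ (hT.add_sub_mem _ hdT _ hdT),
      fun s hs => hposs s (hS s hs)⟩
  have haH := hT.mem_closure a hT.self_mem
  -- The positive even elements of H up to 40. In each case below, elements n excluded from T yield
  -- reflections 39 + a - n in T, whose differences from a restrict d.
  have ha : a = 10 ∨ a = 16 ∨ a = 20 ∨ a = 22 ∨ a = 26 ∨ a = 30 ∨ a = 32 ∨ a = 36 ∨ a = 38 ∨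
      a = 40 := by
    obtain ⟨j, hj, h1, h2⟩ := mem_closure_five_eleven_iff.mp haH
    have := Nat.even_iff.mp heven
    interval_cases j <;> omega
  have no := fun n hn => hT.notMem (n := n) hn
  have nd := fun n hn => hT.notMem_of_double (n := n) hn
  have add := hT.add_sub_mem
  rcases ha with rfl | rfl | rfl | rfl | rfl | rfl | rfl | rfl | rfl | rfl
  -- From 16 ∈ T would follow 22 = 16 + 16 - 10 and then 34 = 22 + 22 - 10, a gap of H. This is what
  -- rules out (10, 16).
  · have h16 : 16 ∉ T := fun h => nd 22 (by decide) (add _ h _ h)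
    have h27 := (hsym 22 (by decide) (by decide)).resolve_left (nd 22 (by decide))
    have h33 := (hsym 16 (by decide) (by decide)).resolve_left h16
    have h := hdiff [17, 23] (by simpa using ⟨h27, h33⟩)
    have key : ∀ d < 40, IsPossibleDifference 10 [17, 23] d → d = 6 ∨ d = 17 := by decide +kernel
    rcases key d hd h with rfl | rfl
    · exact absurd hdT h16
    · exact Or.inl ⟨rfl, rfl⟩
  · have h30 := (hsym 25 (by decide) (by decide)).resolve_left (nd 25 (by decide))
    have h33 := (hsym 22 (by decide) (by decide)).resolve_left (nd 22 (by decide))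
    have h := hdiff [14, 17] (by simpa using ⟨h30, h33⟩)
    have key : ∀ d < 40, ¬ IsPossibleDifference 16 [14, 17] d := by decide +kernel
    exact absurd h (key d hd)
  · have hd' : d = 1 ∨ d = 6 := by
      rcases hsym 26 (by decide) (by decide) with h26 | h33
      · have h := hdiff [6] (by simpa using h26)
        have key : ∀ d < 40, IsPossibleDifference 20 [6] d → d = 1 ∨ d = 6 := by decide +kernel
        exact key d hd h
      · have h32 := (hsym 27 (by decide) (by decide)).resolve_left (nd 27 (by decide))
        have h := hdiff [12, 13] (by simpa using ⟨h32, h33⟩)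
        have key : ∀ d < 40, IsPossibleDifference 20 [12, 13] d → d = 1 ∨ d = 6 := by
          decide +kernel
        exact key d hd h
    rcases hd' with rfl | rfl
    -- From 21 ∈ T come 22 and then 23, a gap of H.
    · exact absurd (add _ (add _ hdT _ hdT) _ hdT) (no 23 (by decide))
    · exact Or.inr ⟨rfl, rfl⟩
  · have h36 := (hsym 25 (by decide) (by decide)).resolve_left (nd 25 (by decide))
    have h35 := (hsym 26 (by decide) (by decide)).resolve_left fun h =>
      no 34 (by decide) (add _ (add _ h _ h) _ h)
    rcases hsym 30 (by decide) (by decide) with h30 | h31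
    · have h := hdiff [8, 14] (by simpa using ⟨h30, h36⟩)
      have key : ∀ d < 40, ¬ IsPossibleDifference 22 [8, 14] d := by decide +kernel
      exact absurd h (key d hd)
    · have h := hdiff [9, 13] (by simpa using ⟨h31, h35⟩)
      have key : ∀ d < 40, ¬ IsPossibleDifference 22 [9, 13] d := by decide +kernel
      exact absurd h (key d hd)
  · have h35 := (hsym 30 (by decide) (by decide)).resolve_left (nd 30 (by decide))
    rcases hsym 32 (by decide) (by decide) with h32 | h33
    · have h := hdiff [6, 9] (by simpa using ⟨h32, h35⟩)
      have key : ∀ d < 40, ¬ IsPossibleDifference 26 [6, 9] d := by decide +kernel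
      exact absurd h (key d hd)
    · have h := hdiff [7, 9] (by simpa using ⟨h33, h35⟩)
      have key : ∀ d < 40, ¬ IsPossibleDifference 26 [7, 9] d := by decide +kernel
      exact absurd h (key d hd)
  · have h38 := (hsym 31 (by decide) (by decide)).resolve_left fun h =>
      nd 32 (by decide) (add _ h _ h)
    have h37 := (hsym 32 (by decide) (by decide)).resolve_left (nd 32 (by decide))
    have h36 := (hsym 33 (by decide) (by decide)).resolve_left fun h =>
      no 39 (by decide) (add _ (add _ h _ h) _ h)
    have h := hdiff [6, 7, 8] (by simpa using ⟨h36, h37, h38⟩)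
    have key : ∀ d < 40, ¬ IsPossibleDifference 30 [6, 7, 8] d := by decide +kernel
    exact absurd h (key d hd)
  · have h38 := (hsym 33 (by decide) (by decide)).resolve_left (nd 33 (by decide))
    rcases hsym 35 (by decide) (by decide) with h35 | h36
    · have h := hdiff [3, 6] (by simpa using ⟨h35, h38⟩)
      have key : ∀ d < 40, ¬ IsPossibleDifference 32 [3, 6] d := by decide +kernel
      exact absurd h (key d hd)
    · have h := hdiff [4, 6] (by simpa using ⟨h36, h38⟩)
      have key : ∀ d < 40, ¬ IsPossibleDifference 32 [4, 6] d := by decide +kernel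
      exact absurd h (key d hd)
  · have h38 := (hsym 37 (by decide) (by decide)).resolve_left fun h =>
      no 39 (by decide) (add _ (add _ h _ h) _ h)
    have h := hdiff [2, 4] (by simpa using ⟨h38, hbig 40 le_rfl⟩)
    have key : ∀ d < 40, ¬ IsPossibleDifference 36 [2, 4] d := by decide +kernel
    exact absurd h (key d hd)
  · have h := hdiff [2, 3] (by simpa using ⟨hbig 40 (by decide), hbig 41 (by decide)⟩)
    have key : ∀ d < 40, ¬ IsPossibleDifference 38 [2, 3] d := by decide +kernel
    exact absurd h (key d hd)
  · have h := hdiff [1, 2, 3] (by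
      simpa using ⟨hbig 41 (by decide), hbig 42 (by decide), hbig 43 (by decide)⟩)
    have key : ∀ d < 40, ¬ IsPossibleDifference 40 [1, 2, 3] d := by decide +kernel
    exact absurd h (key d hd)

end IsReducedOrderSet
end SemigroupRing

/-! ### Order sets of ideals with I² = fI. -/

namespace SemigroupRing

variable {k : Type*} [Field k] {H : AddSubmonoid ℕ}

theorem exists_mem_orderSet_add_eq {I : Ideal (semigroupRing k H)} {f : semigroupRing k H} {a : ℕ}
    (hf : (f : k⟦X⟧).order = a) (hsq : I ^ 2 = Ideal.span {f} * I) {m n : ℕ}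
    (hm : m ∈ orderSet I) (hn : n ∈ orderSet I) : ∃ t ∈ orderSet I, a + t = m + n := by
  obtain ⟨x, hx, hxm⟩ := hm
  obtain ⟨y, hy, hyn⟩ := hn
  have hxy : x * y ∈ Ideal.span {f} * I := by
    rw [← hsq, sq]
    exact Ideal.mul_mem_mul hx hy
  obtain ⟨z, hz, hfz⟩ := Ideal.mem_span_singleton_mul.mp hxy
  have h1 : (f : k⟦X⟧).order + (z : k⟦X⟧).order = ((m + n : ℕ) : ℕ∞) := by
    rw [← PowerSeries.order_mul, ← MulMemClass.coe_mul, hfz, MulMemClass.coe_mul,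
      PowerSeries.order_mul, hxm, hyn, Nat.cast_add]
  have hz0 : (z : k⟦X⟧) ≠ 0 := by
    intro h
    rw [h, PowerSeries.order_zero, add_top] at h1
    exact ENat.natCast_ne_top _ h1.symm
  obtain ⟨t, ht⟩ := exists_order_eq hz0
  rw [hf, ht] at h1
  exact ⟨t, ⟨z, hz, ht⟩, by exact_mod_cast h1⟩

/-- If e is the least order in I, then 2e - a is also an order of I, hence at least e, so a ≤ e. -/
theorem le_of_mem_orderSet {I : Ideal (semigroupRing k H)} {f : semigroupRing k H} {a : ℕ}
    (hf : (f : k⟦X⟧).order = a) (hsq : I ^ 2 = Ideal.span {f} * I) {n : ℕ}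
    (hn : n ∈ orderSet I) : a ≤ n := by
  obtain ⟨e, he, hmin⟩ := WellFounded.has_min (wellFounded_lt (α := ℕ)) (orderSet I) ⟨n, hn⟩
  obtain ⟨t, ht, hte⟩ := exists_mem_orderSet_add_eq hf hsq he he
  have h1 := not_lt.mp (hmin t ht)
  have h2 := not_lt.mp (hmin n hn)
  omega

theorem le_order_of_mem {I : Ideal (semigroupRing k H)} {f : semigroupRing k H} {a : ℕ}
    (hf : (f : k⟦X⟧).order = a) (hsq : I ^ 2 = Ideal.span {f} * I) {x : semigroupRing k H}
    (hx : x ∈ I) : (a : ℕ∞) ≤ (x : k⟦X⟧).order := by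
  by_cases h0 : (x : k⟦X⟧) = 0
  · simp [h0]
  · obtain ⟨n, hn⟩ := exists_order_eq h0
    rw [hn]
    exact_mod_cast le_of_mem_orderSet hf hsq ⟨x, hx, hn⟩

theorem orderIdeal_le_of_mem {I : Ideal (semigroupRing k H)} {f : semigroupRing k H} {a c : ℕ}
    (hf : (f : k⟦X⟧).order = a) (hfI : f ∈ I) (hc : ∀ n, c ≤ n → n ∈ H) :
    orderIdeal k H (a + c) ≤ I := by
  intro x hx
  obtain ⟨y, hxy, hy⟩ := exists_eq_mul_of_order_le hf (mem_orderIdeal.mp hx)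
  have : x = f * ⟨y, mem_of_le_order hc hy⟩ := Subtype.ext hxy
  rw [this]
  exact I.mul_mem_right _ hfI

theorem isReducedOrderSet {I : Ideal (semigroupRing k (AddSubmonoid.closure {5, 11}))}
    {f : semigroupRing k (AddSubmonoid.closure {5, 11})} {a : ℕ}
    (hf : (f : k⟦X⟧).order = a) (hfI : f ∈ I) (hsq : I ^ 2 = Ideal.span {f} * I) :
    IsReducedOrderSet (orderSet I) a where
  mem_closure _ := orderSet_subset
  self_mem := ⟨f, hfI, hf⟩
  le _ := le_of_mem_orderSet hf hsq
  add_sub_mem m hm n hn := by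
    obtain ⟨t, ht, h⟩ := exists_mem_orderSet_add_eq hf hsq hm hn
    rwa [← h, Nat.add_sub_cancel_left]

open Classical in
theorem exists_colength_eq {I : Ideal (semigroupRing k (AddSubmonoid.closure {5, 11}))} {N : ℕ}
    (hN : orderIdeal k (AddSubmonoid.closure {5, 11}) N ≤ I) (h40 : 40 ≤ N) :
    ∃ l : ℕ, colength I = l ∧
      l + ((Finset.range N).filter (· ∈ orderSet I)).card + 20 = N := by
  refine ⟨((Finset.range N).filter (fun n => n ∈ AddSubmonoid.closure ({5, 11} : Set ℕ) ∧
    n ∉ orderSet I)).card, by rw [colength_eq_card hN]; congr!, ?_⟩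
  have h1 := card_filter_mem_closure h40
  have h2 := Finset.card_filter_add_card_filter_not
    (s := (Finset.range N).filter (· ∈ AddSubmonoid.closure ({5, 11} : Set ℕ)))
    (· ∈ orderSet I)
  rw [Finset.filter_filter, Finset.filter_filter] at h2
  have h3 : (Finset.range N).filter
      (fun n => n ∈ AddSubmonoid.closure ({5, 11} : Set ℕ) ∧ n ∈ orderSet I) =
      (Finset.range N).filter (· ∈ orderSet I) :=
    Finset.filter_congr fun n _ => ⟨fun h => h.2, fun h => ⟨orderSet_subset h, h⟩⟩
  rw [h3] at h2
  have h4 : ((Finset.range N).filter (fun n => n ∈ AddSubmonoid.closure ({5, 11} : Set ℕ))).card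
      + 20 = N := by convert h1
  omega

/-- The order of uf + vg is that of one summand unless both have the same order a + m and their
leading terms cancel; then m and m - d are orders of u and v. -/
theorem isPossibleOrder_of_mem_orderSet {f g : semigroupRing k (AddSubmonoid.closure {5, 11})}
    {a d n : ℕ} (hf : (f : k⟦X⟧).order = a) (hg : (g : k⟦X⟧).order = (a + d : ℕ))
    (hn : a + n ∈ orderSet (Ideal.span {f, g})) : IsPossibleOrder d n := by
  obtain ⟨x, hx, hxn⟩ := hn
  obtain ⟨u, v, rfl⟩ := Ideal.mem_span_pair.mp hx
  rw [AddMemClass.coe_add, MulMemClass.coe_mul, MulMemClass.coe_mul] at hxn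
  by_cases hu : (u : k⟦X⟧) = 0
  · rw [hu, zero_mul, zero_add, PowerSeries.order_mul, hg] at hxn
    have hv : (v : k⟦X⟧) ≠ 0 := by
      intro h
      rw [h, PowerSeries.order_zero, top_add] at hxn
      exact ENat.natCast_ne_top _ hxn.symm
    obtain ⟨q, hq⟩ := exists_order_eq hv
    rw [hq] at hxn
    have h1 : q + (a + d) = a + n := by exact_mod_cast hxn
    refine Or.inr (Or.inl ⟨by omega, ?_⟩)
    rw [show n - d = q by omega]
    exact mem_of_order_eq hq
  obtain ⟨p, hp⟩ := exists_order_eq hu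
  have hpH := mem_of_order_eq hp
  have hpf : ((u : k⟦X⟧) * f).order = (p + a : ℕ) := by
    rw [PowerSeries.order_mul, hp, hf, Nat.cast_add]
  by_cases hv : (v : k⟦X⟧) = 0
  · rw [hv, zero_mul, add_zero, hpf] at hxn
    have h1 : p + a = a + n := by exact_mod_cast hxn
    refine Or.inl ?_
    rwa [show n = p by omega]
  obtain ⟨q, hq⟩ := exists_order_eq hv
  have hqH := mem_of_order_eq hq
  have hqg : ((v : k⟦X⟧) * g).order = (q + (a + d) : ℕ) := by
    rw [PowerSeries.order_mul, hq, hg, Nat.cast_add q]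
  by_cases heq : p + a = q + (a + d)
  · have h1 := PowerSeries.min_order_le_order_add ((u : k⟦X⟧) * (f : k⟦X⟧)) ((v : k⟦X⟧) * (g : k⟦X⟧))
    rw [hpf, hqg, heq, min_self, hxn] at h1
    have h2 : q + (a + d) ≤ a + n := by exact_mod_cast h1
    rcases Nat.lt_or_ge p n with h | h
    · refine Or.inr (Or.inr ⟨p, h, by omega, hpH, ?_⟩)
      rwa [show p - d = q by omega]
    · refine Or.inl ?_
      rwa [show n = p by omega]
  · rw [PowerSeries.order_add_of_order_ne _ _ (by rw [hpf, hqg]; exact_mod_cast heq), hpf, hqg] at hxn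
    rcases le_total (p + a) (q + (a + d)) with h | h
    · rw [min_eq_left (by exact_mod_cast h)] at hxn
      have h1 : p + a = a + n := by exact_mod_cast hxn
      refine Or.inl ?_
      rwa [show n = p by omega]
    · rw [min_eq_right (by exact_mod_cast h)] at hxn
      have h1 : q + (a + d) = a + n := by exact_mod_cast hxn
      refine Or.inr (Or.inl ⟨by omega, ?_⟩)
      rwa [show n - d = q by omega]

theorem _root_.IsNormalizedPair.classification
    {I : Ideal (semigroupRing k (AddSubmonoid.closure {5, 11}))}
    {f g : semigroupRing k (AddSubmonoid.closure {5, 11})} {a b : ℕ}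
    (h : IsNormalizedPair I f g a b) : (a = 10 ∧ b = 27) ∨ (a = 20 ∧ b = 26) := by
  have hfI : f ∈ I := by
    rw [h.eq_span]
    exact Ideal.subset_span (by simp)
  have hgI : g ∈ I := by
    rw [h.eq_span]
    exact Ideal.subset_span (by simp)
  have hT := isReducedOrderSet h.order_f hfI h.sq_eq
  obtain ⟨l, hl, hcard⟩ := exists_colength_eq
    (orderIdeal_le_of_mem h.order_f hfI fun n => mem_closure_of_forty_le) (by omega)
  have hcard' := Nat.add_right_cancel (hcard.trans (show a + 40 = a + 20 + 20 by omega))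
  have ha : a = 2 * l := by
    have := h.a_eq
    rw [hl] at this
    exact_mod_cast this
  have hbig : ∀ n, 40 ≤ n → n ∈ orderSet I := fun n hn =>
    hT.mem_of_forty_le hcard' ha h.a_pos (fun n hn m hm => add_mem_orderSet hn hm) hn
  have hab := h.a_lt_b
  have hb := h.b_lt
  rw [semigroupConductor_five_eleven] at hb
  have hba : a + (b - a) = b := by omega
  have := hT.classification hbig (fun n => hT.mem_or_reflect_mem hcard' ha)
    (hT.le 40 (hbig 40 le_rfl)) h.a_pos ⟨l, by omega⟩ (d := b - a) (by omega) h.sub_notMem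
    (by rw [hba]; exact ⟨g, hgI, h.order_g⟩) fun n hn =>
      isPossibleOrder_of_mem_orderSet h.order_f (by rw [hba]; exact h.order_g) (h.eq_span ▸ hn)
  omega

/-! ### Dimension one and parameter ideals. -/

instance krullDimLE_one : Ring.KrullDimLE 1 (semigroupRing k (AddSubmonoid.closure {5, 11})) := by
  have : (⊥ : Ideal (semigroupRing k (AddSubmonoid.closure {5, 11}))).IsPrime := Ideal.isPrime_bot
  refine Ring.krullDimLE_one_iff_of_isPrime_bot.mpr fun P hP0 hP => ?_
  obtain ⟨f, hfP, hf0⟩ := Submodule.exists_mem_ne_zero_of_ne_bot hP0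
  obtain ⟨a, ha⟩ := exists_order_eq (coe_ne_zero hf0)
  have hle := orderIdeal_le_of_mem ha hfP fun n => mem_closure_of_forty_le
  have : P = IsLocalRing.maximalIdeal _ := by
    refine le_antisymm (IsLocalRing.le_maximalIdeal hP.ne_top) fun x hx => ?_
    -- A nonzero prime contains all elements of order at least a + 40, hence a power of every
    -- nonunit.
    refine hP.mem_of_pow_mem (a + 40) (hle (mem_orderIdeal.mpr ?_))
    rw [SubmonoidClass.coe_pow, PowerSeries.order_pow, nsmul_eq_mul]
    exact le_mul_of_one_le_right' (mem_maximalIdeal_iff.mp hx)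
  rw [this]
  exact IsLocalRing.maximalIdeal.isMaximal _

theorem _root_.IsParameterIdeal.exists_eq_span
    {Q : Ideal (semigroupRing k (AddSubmonoid.closure {5, 11}))} (hQ : IsParameterIdeal Q) :
    ∃ (f : semigroupRing k (AddSubmonoid.closure {5, 11})) (a : ℕ), Q = Ideal.span {f} ∧
      (f : k⟦X⟧).order = a ∧ 0 < a := by
  obtain ⟨d, x, hd, hQx, hrad⟩ := hQ
  have hd1 : d ≤ 1 := by
    have := (Order.krullDimLE_iff 1 _).mp
      (krullDimLE_one (k := k) : Ring.KrullDimLE 1 (semigroupRing k (AddSubmonoid.closure {5, 11})))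
    rw [← ringKrullDim, hd] at this
    exact_mod_cast this
  have hQ0 : Q ≠ ⊥ := by
    rintro rfl
    have h5 : 5 ∈ AddSubmonoid.closure ({5, 11} : Set ℕ) := AddSubmonoid.subset_closure (by simp)
    let u : semigroupRing k (AddSubmonoid.closure {5, 11}) := ⟨_, monomial_mem h5⟩
    have hu : (u : k⟦X⟧).order = (5 : ℕ) := PowerSeries.order_monomial_of_ne_zero _ _ one_ne_zero
    have hm : u ∈ IsLocalRing.maximalIdeal (semigroupRing k (AddSubmonoid.closure {5, 11})) := by
      rw [mem_maximalIdeal_iff, hu]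
      norm_num
    rw [← hrad, Ideal.isPrime_bot.radical, Ideal.mem_bot] at hm
    exact ne_zero_of_order_eq hu (by rw [hm]; rfl)
  obtain ⟨f, rfl⟩ : ∃ f, Q = Ideal.span {f} := by
    interval_cases d
    · exact absurd (by simpa using hQx) hQ0
    · exact ⟨x 0, by rw [hQx, Set.range_unique]; rfl⟩
  have hf0 : f ≠ 0 := by
    rintro rfl
    simp at hQ0
  obtain ⟨a, ha⟩ := exists_order_eq (coe_ne_zero hf0)
  refine ⟨f, a, rfl, ha, ?_⟩
  have hfm : f ∈ IsLocalRing.maximalIdeal (semigroupRing k (AddSubmonoid.closure {5, 11})) := by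
    rw [← hrad]
    exact Ideal.le_radical (Ideal.mem_span_singleton_self f)
  rw [mem_maximalIdeal_iff, ha] at hfm
  exact_mod_cast hfm

end SemigroupRing

/-! ### Generators of I and the length of A/I². -/

theorem Ideal.exists_generators_of_rank_cotangent_eq_two {A : Type*} [CommRing A] {I : Ideal A}
    [Nontrivial (A ⧸ I)] [Module.Free (A ⧸ I) I.Cotangent]
    (h : (Module.rank (A ⧸ I) I.Cotangent).toENat = 2) :
    ∃ e₁ ∈ I, ∃ e₂ ∈ I, ∀ x ∈ I, ∃ α β : A, x - (α * e₁ + β * e₂) ∈ I ^ 2 := by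
  let b := Module.Free.chooseBasis (A ⧸ I) I.Cotangent
  rw [Module.Free.rank_eq_card_chooseBasisIndex, Cardinal.toENat_eq_ofNat] at h
  obtain ⟨i, j, hij, huniv⟩ := Cardinal.mk_eq_two_iff.mp h
  obtain ⟨e₁, he₁⟩ := I.toCotangent_surjective (b i)
  obtain ⟨e₂, he₂⟩ := I.toCotangent_surjective (b j)
  refine ⟨e₁, e₁.2, e₂, e₂.2, fun x hx => ?_⟩
  have hmem : I.toCotangent ⟨x, hx⟩ ∈ Submodule.span (A ⧸ I) (Set.range b) := by
    rw [b.span_eq]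
    trivial
  rw [← Set.image_univ, ← huniv, Set.image_pair, Submodule.mem_span_pair] at hmem
  obtain ⟨α', β', h'⟩ := hmem
  obtain ⟨α, rfl⟩ := Ideal.Quotient.mk_surjective α'
  obtain ⟨β, rfl⟩ := Ideal.Quotient.mk_surjective β'
  refine ⟨α, β, ?_⟩
  have h2 : I.toCotangent ⟨x, hx⟩ = I.toCotangent (α • e₁ + β • e₂) := by
    rw [map_add, map_smul, map_smul, he₁, he₂, ← h']
    rfl
  simpa using I.toCotangent_eq.mp h2

namespace SemigroupRing

variable {k : Type*} [Field k] {H : AddSubmonoid ℕ}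

theorem orderSet_sq {I : Ideal (semigroupRing k H)} {f : semigroupRing k H} {a : ℕ}
    (hf : (f : k⟦X⟧).order = a) (hsq : I ^ 2 = Ideal.span {f} * I) {n : ℕ} :
    a + n ∈ orderSet (I ^ 2) ↔ n ∈ orderSet I := by
  rw [hsq]
  constructor
  · rintro ⟨x, hx, hxn⟩
    obtain ⟨z, hz, rfl⟩ := Ideal.mem_span_singleton_mul.mp hx
    refine ⟨z, hz, ?_⟩
    rw [MulMemClass.coe_mul, PowerSeries.order_mul, hf, Nat.cast_add] at hxn
    exact ENat.add_right_injective_of_ne_top (ENat.natCast_ne_top a) hxn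
  · rintro ⟨z, hz, hzn⟩
    refine ⟨f * z, Ideal.mem_span_singleton_mul.mpr ⟨z, hz, rfl⟩, ?_⟩
    rw [MulMemClass.coe_mul, PowerSeries.order_mul, hf, hzn, Nat.cast_add]

/-- The order set of I² = fI is a + T, so both lengths are counted by the same number of orders, in
windows whose lengths differ by a. -/
theorem colength_sq_eq_add {I : Ideal (semigroupRing k (AddSubmonoid.closure {5, 11}))}
    {f : semigroupRing k (AddSubmonoid.closure {5, 11})} {a : ℕ}
    (hf : (f : k⟦X⟧).order = a) (hfI : f ∈ I) (hsq : I ^ 2 = Ideal.span {f} * I) :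
    colength (I ^ 2) = a + colength I := by
  classical
  have hf2 : ((f * f : semigroupRing k (AddSubmonoid.closure {5, 11})) : k⟦X⟧).order =
      (a + a : ℕ) := by
    rw [MulMemClass.coe_mul, PowerSeries.order_mul, hf, Nat.cast_add]
  obtain ⟨l, hl, hc⟩ := exists_colength_eq
    (orderIdeal_le_of_mem hf hfI fun n => mem_closure_of_forty_le) (by omega)
  obtain ⟨l', hl', hc'⟩ := exists_colength_eq
    (orderIdeal_le_of_mem hf2 (sq I ▸ Ideal.mul_mem_mul hfI hfI) fun n => mem_closure_of_forty_le)
    (by omega)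
  have hcard : ((Finset.range (a + a + 40)).filter (· ∈ orderSet (I ^ 2))).card =
      ((Finset.range (a + 40)).filter (· ∈ orderSet I)).card := by
    symm
    refine Finset.card_nbij (a + ·) ?_ (fun _ _ _ _ h => Nat.add_left_cancel h) ?_
    · intro n hn
      simp only [Finset.coe_filter, Finset.mem_range, Set.mem_ofPred_eq] at hn ⊢
      exact ⟨by omega, (orderSet_sq hf hsq).mpr hn.2⟩
    · intro n hn
      simp only [Finset.coe_filter, Finset.mem_range, Set.mem_ofPred_eq, Set.mem_image] at hn ⊢
      have han : a ≤ n := by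
        obtain ⟨x, hx, hxn⟩ := hn.2
        exact le_of_mem_orderSet hf hsq ⟨x, Ideal.pow_le_self two_ne_zero hx, hxn⟩
      obtain ⟨m, rfl⟩ := Nat.exists_eq_add_of_le han
      exact ⟨m, ⟨by omega, (orderSet_sq hf hsq).mp hn.2⟩, rfl⟩
  rw [hl, hl']
  have h1 : l + ((Finset.range (a + 40)).filter (· ∈ orderSet I)).card + 20 = a + 40 := by
    convert hc
  have h2 : l' + ((Finset.range (a + a + 40)).filter (· ∈ orderSet (I ^ 2))).card + 20 =
      a + a + 40 := by
    convert hc'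
  have h3 : l' = a + l := by omega
  exact_mod_cast h3

/-- Length a leaves I only 20 orders below a + 40, and a + (H ∩ [0, 40)) already supplies 20 from
(f). -/
theorem le_span_singleton_of_colength_eq {I : Ideal (semigroupRing k (AddSubmonoid.closure {5, 11}))}
    {f : semigroupRing k (AddSubmonoid.closure {5, 11})} {a : ℕ}
    (hf : (f : k⟦X⟧).order = a) (hfI : f ∈ I) (hl : colength I = a) : I ≤ Ideal.span {f} := by
  classical
  have hfN := orderIdeal_le_of_mem hf (Ideal.mem_span_singleton_self f)
    fun n => mem_closure_of_forty_le
  have hle : Ideal.span {f} ≤ I := (Ideal.span_singleton_le_iff_mem I).mpr hfI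
  refine le_of_orderSet_subset hle hfN ?_
  obtain ⟨l, hl', hc⟩ := exists_colength_eq (hfN.trans hle) (by omega)
  have hla : l = a := by
    rw [hl] at hl'
    exact_mod_cast hl'.symm
  have hsub : (Finset.range (a + 40)).filter (· ∈ orderSet (Ideal.span {f})) ⊆
      (Finset.range (a + 40)).filter (· ∈ orderSet I) := by
    intro n hn
    rw [Finset.mem_filter] at hn ⊢
    exact ⟨hn.1, hn.2.imp fun x hx => ⟨hle hx.1, hx.2⟩⟩
  have hcard : 20 ≤ ((Finset.range (a + 40)).filter (· ∈ orderSet (Ideal.span {f}))).card := by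
    have h1 := card_filter_mem_closure (N := 40) le_rfl
    rw [← Nat.add_right_cancel (h1.trans (show 40 = 20 + 20 by rfl))]
    refine Finset.card_le_card_of_injOn (a + ·) ?_ fun _ _ _ _ h => Nat.add_left_cancel h
    intro n hn
    simp only [Finset.coe_filter, Finset.mem_range, Set.mem_ofPred_eq] at hn ⊢
    exact ⟨by omega, add_mem_orderSet ⟨f, Ideal.mem_span_singleton_self f, hf⟩ hn.2⟩
  have heq := Finset.eq_of_subset_of_card_le hsub (by
    have h1 : l + ((Finset.range (a + 40)).filter (· ∈ orderSet I)).card + 20 = a + 40 := by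
      convert hc
    omega)
  intro n hn hnI
  have : n ∈ (Finset.range (a + 40)).filter (· ∈ orderSet I) := by simp [hn, hnI]
  rw [← heq] at this
  exact (Finset.mem_filter.mp this).2

theorem exists_eq_span_pair {I : Ideal (semigroupRing k H)} {f : semigroupRing k H} {a : ℕ}
    (hf : (f : k⟦X⟧).order = a) (hfI : f ∈ I) (hsq : I ^ 2 = Ideal.span {f} * I) (ha : 0 < a)
    {e₁ e₂ : semigroupRing k H} (he₁ : e₁ ∈ I) (he₂ : e₂ ∈ I)
    (h : ∀ x ∈ I, ∃ α β, x - (α * e₁ + β * e₂) ∈ I ^ 2) : ∃ g, I = Ideal.span {f, g} := by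
  -- This replaces Nakayama: once f is among the generators, generation modulo I² is generation.
  have hsqf : I ^ 2 ≤ Ideal.span {f} := hsq ▸ Ideal.mul_le_left
  have key : ∀ {e e' : semigroupRing k H}, e ∈ I → e' ∈ I →
      (∀ x ∈ I, ∃ α β, x - (α * e + β * e') ∈ I ^ 2) →
      (∃ α β, IsUnit α ∧ f - (α * e + β * e') ∈ I ^ 2) → ∃ g, I = Ideal.span {f, g} := by
    rintro e e' he he' hx ⟨α, β, ⟨u, rfl⟩, hfe⟩
    refine ⟨e', le_antisymm ?_ (Ideal.span_le.mpr (by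
      rintro x (rfl | rfl)
      · exact hfI
      · exact he'))⟩
    have hfs : f ∈ Ideal.span {f, e'} := Ideal.subset_span (by simp)
    have hes : e' ∈ Ideal.span {f, e'} := Ideal.subset_span (by simp)
    have hsq' : I ^ 2 ≤ Ideal.span {f, e'} :=
      hsqf.trans ((Ideal.span_singleton_le_iff_mem _).mpr hfs)
    have hes1 : e ∈ Ideal.span {f, e'} := by
      have : e = ↑u⁻¹ * (f - β * e' - (f - (u * e + β * e'))) := by
        have : (↑u⁻¹ : semigroupRing k H) * u = 1 := u.inv_mul
        linear_combination (-e) * this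
      rw [this]
      exact Ideal.mul_mem_left _ _ (sub_mem (sub_mem hfs (Ideal.mul_mem_left _ _ hes)) (hsq' hfe))
    intro x hxI
    obtain ⟨α', β', h'⟩ := hx x hxI
    have : x = (α' * e + β' * e') + (x - (α' * e + β' * e')) := by ring
    rw [this]
    exact add_mem (add_mem (Ideal.mul_mem_left _ _ hes1) (Ideal.mul_mem_left _ _ hes)) (hsq' h')
  obtain ⟨α, β, hfe⟩ := h f hfI
  by_cases hα : IsUnit α
  · exact key he₁ he₂ h ⟨α, β, hα, hfe⟩
  by_cases hβ : IsUnit β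
  · refine key he₂ he₁ (fun x hx => ?_) ⟨β, α, hβ, by rwa [add_comm]⟩
    obtain ⟨α', β', h'⟩ := h x hx
    exact ⟨β', α', by rwa [add_comm]⟩
  -- With both coefficients nonunits, f would have order greater than a, the least order in I.
  exfalso
  have hnu : ∀ {α e : semigroupRing k H}, ¬ IsUnit α → e ∈ I → α * e ∈ orderIdeal k H (a + 1) := by
    intro α e hα he
    have h1 : 1 ≤ (α : k⟦X⟧).order := mem_maximalIdeal_iff.mp hα
    rw [mem_orderIdeal, MulMemClass.coe_mul, PowerSeries.order_mul, add_comm, Nat.cast_add,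
      Nat.cast_one]
    exact add_le_add h1 (le_order_of_mem hf hsq he)
  have h2 : I ^ 2 ≤ orderIdeal k H (a + 1) := by
    rw [hsq]
    intro x hx
    obtain ⟨z, hz, rfl⟩ := Ideal.mem_span_singleton_mul.mp hx
    refine hnu (fun hu => ?_) hz
    rw [isUnit_iff_order_eq_zero, hf] at hu
    exact ha.ne' (by exact_mod_cast hu)
  have h3 : f ∈ orderIdeal k H (a + 1) := by
    have : f = (α * e₁ + β * e₂) + (f - (α * e₁ + β * e₂)) := by ring
    rw [this]
    exact add_mem (add_mem (hnu hα he₁) (hnu hβ he₂)) (h2 hfe)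
  rw [mem_orderIdeal, hf] at h3
  exact absurd h3 (by exact_mod_cast Nat.not_succ_le_self a)

/-- The second generator can be chosen in `f k[[t]]` with quotient supported on the gaps of `H`. -/
theorem exists_eq_span_pair_gap {I : Ideal (semigroupRing k H)} {f g : semigroupRing k H} {a : ℕ}
    (hf : (f : k⟦X⟧).order = a) (hI : I = Ideal.span {f, g}) (hne : I ≠ Ideal.span {f})
    (hg : (a : ℕ∞) ≤ (g : k⟦X⟧).order) :
    ∃ (g' : semigroupRing k H) (h : k⟦X⟧) (d : ℕ), I = Ideal.span {f, g'} ∧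
      (g' : k⟦X⟧) = f * h ∧ h.order = d ∧ d ∉ H := by
  classical
  obtain ⟨h, hgh, -⟩ := exists_eq_mul_of_order_le (m := 0) hf hg
  -- The part of h = g/f supported on H lies in A, so its multiple of f can be subtracted from g.
  let s : semigroupRing k H :=
    ⟨PowerSeries.mk fun n => if n ∈ H then PowerSeries.coeff n h else 0, fun n hn => by
      rw [PowerSeries.coeff_mk] at hn
      by_contra h'
      exact hn (if_neg h')⟩
  have hs : ∀ n, PowerSeries.coeff n (h - (s : k⟦X⟧)) ≠ 0 → n ∉ H := by
    intro n hn hnH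
    refine hn ?_
    rw [map_sub, PowerSeries.coeff_mk, if_pos hnH, sub_self]
  have hspan : Ideal.span {f, g} = Ideal.span {f, g + (-s) * f} := (Ideal.span_pair_add_mul_left ..).symm
  have hcoe : ((g + (-s) * f : semigroupRing k H) : k⟦X⟧) = f * (h - (s : k⟦X⟧)) := by
    simp only [AddMemClass.coe_add, MulMemClass.coe_mul, NegMemClass.coe_neg, hgh]
    ring
  have h0 : h - (s : k⟦X⟧) ≠ 0 := by
    intro h0
    rw [h0, mul_zero] at hcoe
    refine hne ?_
    have h1 : g + (-s) * f = 0 := Subtype.ext hcoe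
    rw [hI, hspan, h1, Ideal.span_pair_zero]
  obtain ⟨d, hd⟩ := exists_order_eq h0
  exact ⟨g + (-s) * f, h - (s : k⟦X⟧), d, hI.trans hspan, hcoe, hd, hs d (coeff_ne_zero_of_order_eq hd)⟩

end SemigroupRing

/-! ### Duality, the rank of I/I², and existence of a normalized pair. -/

namespace SemigroupRing

variable {k : Type*} [Field k]

theorem orderIdeal_forty_le {x : semigroupRing k (AddSubmonoid.closure {5, 11})}
    (hx : ∀ v : k⟦X⟧, (x : k⟦X⟧) * v ∈ semigroupRing k (AddSubmonoid.closure {5, 11})) :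
    x ∈ orderIdeal k (AddSubmonoid.closure {5, 11}) 40 := by
  by_cases h0 : (x : k⟦X⟧) = 0
  · simp [mem_orderIdeal, h0]
  obtain ⟨n, hn⟩ := exists_order_eq h0
  rw [mem_orderIdeal, hn]
  by_contra h
  have h40 : n < 40 := by
    by_contra h'
    exact h (by exact_mod_cast not_lt.mp h')
  have h1 : ((x : k⟦X⟧) * PowerSeries.X ^ (39 - n)).order = ((39 : ℕ) : ℕ∞) := by
    rw [PowerSeries.order_mul, hn, PowerSeries.order_X_pow, ← Nat.cast_add,
      Nat.add_sub_cancel' (by omega)]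
  exact thirtyNine_notMem (mem_of_order_eq (x := ⟨_, hx _⟩) h1)

/-- The ideal J = A : h contains I, since fh = g and gh = g²/f ∈ I. Conversely (1/f)JI ⊆ A, so an
order n of J and an order t of I never satisfy n + t - a = 39; the symmetry of T then puts n in T.
-/
theorem mem_of_mul_mem {I : Ideal (semigroupRing k (AddSubmonoid.closure {5, 11}))}
    {f g : semigroupRing k (AddSubmonoid.closure {5, 11})} {h : k⟦X⟧} {a : ℕ}
    (hf : (f : k⟦X⟧).order = a) (hI : I = Ideal.span {f, g}) (hgh : (g : k⟦X⟧) = f * h)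
    (hsq : I ^ 2 = Ideal.span {f} * I)
    (h40 : orderIdeal k (AddSubmonoid.closure {5, 11}) 40 ≤ I)
    (hbig : ∀ n, 40 ≤ n → n ∈ orderSet I)
    (hsym : ∀ n, a ≤ n → n < 40 → n ∈ orderSet I ∨ 39 + a - n ∈ orderSet I)
    {x : semigroupRing k (AddSubmonoid.closure {5, 11})}
    (hx : (x : k⟦X⟧) * h ∈ semigroupRing k (AddSubmonoid.closure {5, 11})) : x ∈ I := by
  have hf0 : (f : k⟦X⟧) ≠ 0 := ne_zero_of_order_eq hf
  let J : Ideal (semigroupRing k (AddSubmonoid.closure {5, 11})) :=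
    { carrier := {y | (y : k⟦X⟧) * h ∈ semigroupRing k (AddSubmonoid.closure {5, 11})}
      add_mem' := fun {y z} hy hz => by
        rw [Set.mem_ofPred_eq, AddMemClass.coe_add, add_mul]
        exact add_mem hy hz
      zero_mem' := by
        rw [Set.mem_ofPred_eq, ZeroMemClass.coe_zero, zero_mul]
        exact zero_mem _
      smul_mem' := fun c y hy => by
        rw [Set.mem_ofPred_eq, smul_eq_mul, MulMemClass.coe_mul, mul_assoc]
        exact mul_mem c.2 hy }
  have hJ : ∀ {y}, y ∈ J ↔ (y : k⟦X⟧) * h ∈ semigroupRing k (AddSubmonoid.closure {5, 11}) :=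
    Iff.rfl
  have hIJ : I ≤ J := by
    rw [hI, Ideal.span_le]
    have hgI : g ∈ I := hI ▸ Ideal.subset_span (by simp)
    rintro y (rfl | rfl)
    · rw [SetLike.mem_coe, hJ, ← hgh]
      exact g.2
    · have hyy : y * y ∈ Ideal.span {f} * I := by
        rw [← hsq, sq]
        exact Ideal.mul_mem_mul hgI hgI
      obtain ⟨z, hz, hfz⟩ := Ideal.mem_span_singleton_mul.mp hyy
      have hfz' : (f : k⟦X⟧) * z = y * y := by
        rw [← MulMemClass.coe_mul, hfz, MulMemClass.coe_mul]
      have : (y : k⟦X⟧) * h = z := by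
        refine mul_left_cancel₀ hf0 ?_
        rw [hfz', mul_left_comm, ← hgh]
      rw [SetLike.mem_coe, hJ, this]
      exact z.2
  refine le_of_orderSet_subset hIJ h40 (fun n hn hnJ => ?_) (hJ.mpr hx)
  obtain ⟨y, hy, hyn⟩ := hnJ
  have hadd : ∀ t ∈ orderSet I, n + t ≠ 39 + a := by
    rintro t ⟨i, hi, hit⟩ hnt
    rw [hI] at hi
    obtain ⟨α, β, rfl⟩ := Ideal.mem_span_pair.mp hi
    -- The quotient y(αf + βg)/f, in A because yh is.
    let w : semigroupRing k (AddSubmonoid.closure {5, 11}) := α * y + β * ⟨_, hJ.mp hy⟩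
    have hw : (f : k⟦X⟧) * w = y * (α * f + β * g : semigroupRing k _) := by
      simp only [w, AddMemClass.coe_add, MulMemClass.coe_mul, hgh]
      ring
    have h1 : (a : ℕ∞) + (w : k⟦X⟧).order = a + (39 : ℕ) := by
      rw [← hf, ← PowerSeries.order_mul, hw, PowerSeries.order_mul, hyn, hit, hf, ← Nat.cast_add,
        hnt, add_comm, Nat.cast_add]
    exact thirtyNine_notMem
      (mem_of_order_eq (ENat.add_right_injective_of_ne_top (ENat.natCast_ne_top a) h1))
  by_cases han : a ≤ n
  · refine (hsym n han hn).resolve_right fun h' => hadd _ h' (by omega)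
  -- For n < a the reflection is at least 40, so it lies in T.
  · exact absurd (by omega) (hadd _ (hbig (39 + a - n) (by omega)))

theorem rank_cotangent_eq_two {I : Ideal (semigroupRing k (AddSubmonoid.closure {5, 11}))}
    {f : semigroupRing k (AddSubmonoid.closure {5, 11})} {a : ℕ}
    [Module.Free (semigroupRing k (AddSubmonoid.closure {5, 11}) ⧸ I) I.Cotangent]
    (hf : (f : k⟦X⟧).order = a) (hfI : f ∈ I) (hsq : I ^ 2 = Ideal.span {f} * I) (ha : 0 < a)
    (hne : I ≠ Ideal.span {f}) :
    (Module.rank (semigroupRing k (AddSubmonoid.closure {5, 11}) ⧸ I) I.Cotangent).toENat = 2 ∧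
      (a : ℕ∞) = 2 * colength I := by
  have hT := isReducedOrderSet hf hfI hsq
  obtain ⟨l, hl, hc⟩ := exists_colength_eq
    (orderIdeal_le_of_mem hf hfI fun n => mem_closure_of_forty_le) (by omega)
  have hal := hT.le_two_mul (Nat.add_right_cancel (hc.trans (show a + 40 = a + 20 + 20 by omega)))
  have hmul := colength_sq I
  rw [colength_sq_eq_add hf hfI hsq, hl] at hmul
  generalize (Module.rank (semigroupRing k (AddSubmonoid.closure {5, 11}) ⧸ I)
    I.Cotangent).toENat = r at hmul ⊢
  have hr : r ≠ ⊤ := by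
    rintro rfl
    rw [ENat.top_mul (by exact_mod_cast (by omega : l ≠ 0)), top_add, ← Nat.cast_add] at hmul
    exact ENat.natCast_ne_top _ hmul
  lift r to ℕ using hr
  have h1 : a = r * l := by
    have : a + l = r * l + l := by exact_mod_cast hmul
    omega
  have hr2 : r ≤ 2 := by
    have : r * l ≤ 2 * l := by omega
    exact Nat.le_of_mul_le_mul_right this (by omega)
  interval_cases r
  · omega
  · exact absurd (le_antisymm (le_span_singleton_of_colength_eq hf hfI (by rw [hl, h1, one_mul]))
      ((Ideal.span_singleton_le_iff_mem I).mpr hfI)) hne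
  · refine ⟨by norm_num, ?_⟩
    rw [hl, h1]
    norm_num

theorem _root_.IsUlrichIdeal.exists_isNormalizedPair
    {I : Ideal (semigroupRing k (AddSubmonoid.closure {5, 11}))} (hI : IsUlrichIdeal I) :
    ∃ f g a b, IsNormalizedPair I f g a b := by
  obtain ⟨hrad, ⟨Q, hQ, hQI, hne, hsq⟩, hfree⟩ := hI
  obtain ⟨f, a, rfl, hf, ha⟩ := hQ.exists_eq_span
  have hfI : f ∈ I := hQI (Ideal.mem_span_singleton_self f)
  have hT := isReducedOrderSet hf hfI hsq
  obtain ⟨hrank, hcol⟩ := rank_cotangent_eq_two hf hfI hsq ha hne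
  obtain ⟨l, hl, hc⟩ := exists_colength_eq
    (orderIdeal_le_of_mem hf hfI fun n => mem_closure_of_forty_le) (by omega)
  have hc' := Nat.add_right_cancel (hc.trans (show a + 40 = a + 20 + 20 by omega))
  have hal : a = 2 * l := by
    rw [hl] at hcol
    exact_mod_cast hcol
  have hbig : ∀ n, 40 ≤ n → n ∈ orderSet I := fun n hn =>
    hT.mem_of_forty_le hc' hal ha (fun n hn m hm => add_mem_orderSet hn hm) hn
  have h40 : orderIdeal k (AddSubmonoid.closure {5, 11}) 40 ≤ I :=
    orderIdeal_le_of_mem_orderSet (orderIdeal_le_of_mem hf hfI fun n => mem_closure_of_forty_le) hbig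
  have : Nontrivial (semigroupRing k (AddSubmonoid.closure {5, 11}) ⧸ I) := by
    refine Ideal.Quotient.nontrivial_iff.mpr ?_
    rintro rfl
    rw [Ideal.radical_top] at hrad
    exact (IsLocalRing.maximalIdeal.isMaximal _).ne_top hrad.symm
  obtain ⟨e₁, he₁, e₂, he₂, he⟩ := Ideal.exists_generators_of_rank_cotangent_eq_two hrank
  obtain ⟨g₀, hg₀⟩ := exists_eq_span_pair hf hfI hsq ha he₁ he₂ he
  obtain ⟨g, h, d, hfg, hgh, hd, hdH⟩ := exists_eq_span_pair_gap hf hg₀ hne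
    (le_order_of_mem hf hsq (hg₀ ▸ Ideal.subset_span (by simp)))
  have hgI : g ∈ I := hfg ▸ Ideal.subset_span (by simp)
  have hg : (g : k⟦X⟧).order = (a + d : ℕ) := by
    rw [hgh, PowerSeries.order_mul, hf, hd, Nat.cast_add]
  have hd0 : d ≠ 0 := by
    rintro rfl
    exact hdH (zero_mem _)
  have hd40 : d < 40 := by
    by_contra h'
    exact hdH (mem_closure_of_forty_le (not_lt.mp h'))
  refine ⟨f, g, a, a + d, ⟨hf, hg, hfg, hsq, mem_of_order_eq hf, mem_of_order_eq hg, ha, by omega,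
    ?_, ?_, ?_, hcol, ?_, fun x hx => h40 (orderIdeal_forty_le hx)⟩⟩
  · rw [semigroupConductor_five_eleven]
    omega
  · rwa [Nat.add_sub_cancel_left]
  · have := hT.mem_closure _ (hT.add_sub_mem _ ⟨g, hgI, hg⟩ _ ⟨g, hgI, hg⟩)
    rwa [← two_mul] at this
  · intro x hx
    rw [semigroupConductor_five_eleven, Nat.add_sub_cancel_left] at hx
    -- As o(x) ≥ 40 - d and o(h) = d, the product xh has order at least 40 and lies in A.
    refine mem_of_mul_mem hf hfg hgh hsq h40 hbig (fun n => hT.mem_or_reflect_mem hc' hal)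
      (mem_of_le_order (c := 40) (fun n => mem_closure_of_forty_le) ?_)
    rw [PowerSeries.order_mul, hd]
    refine le_trans ?_ (add_le_add_left hx _)
    rw [← Nat.cast_add, Nat.sub_add_cancel hd40.le]

end SemigroupRing

theorem mainTheorem9 (k : Type*) [Field k]
    (I : Ideal (semigroupRing k (AddSubmonoid.closure {5, 11}))) (hI : IsUlrichIdeal I) :
    (∃ f g a b, IsNormalizedPair I f g a b) ∧
    ∀ f g a b, IsNormalizedPair I f g a b →
      (a, b) ≠ (10, 16) ∧ ((a, b) = (10, 27) ∨ (a, b) = (20, 26)) := by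
  refine ⟨hI.exists_isNormalizedPair, fun f g a b h => ?_⟩
  rcases h.classification with ⟨rfl, rfl⟩ | ⟨rfl, rfl⟩ <;> simp
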